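/- Theorem 1.1. Let $E\subset\mathbb{R}^n$ be arbitrary, let $f:E\to\mathbb{R}$ and $G:E\to\mathbb{R}^n$ be functions with $G$ non-constant, and let $X\subset\mathbb{R}^n$ be a linear subspace. Put $Y:=\operatorname{span}\{G(x)-G(y): x,y\in E\}$; for a linear subspace $Z$ let $P_Z$ denote the orthogonal projection onto $Z$. Assume: - $(C_b)$ $G$ is continuous and bounded on $E$, and $f(x)\ge f(y)+\langle G(y),x-y\rangle$ for all $x,y\in E$. - $(S_{Y,X})$ $Y\subseteq X$. - $(C_{Y,X})$ If $Y\ne X$, and $k=\dim Y$, $d=\dim X$, there are points $p_1,\dots,p_{d-k}\in\mathbb{R}^n\setminus\overline{E}$, a number $\varepsilon\in(0,1)$, and linearly independent unit vectors $w_1,\dots,w_{d-k}\in X\cap Y^\perp$ such that, for every $j=1,\dots,d-k$, the cone $V_j=\{x\in\mathbb{R}^n:\ \varepsilon\langle w_j,x-p_j\rangle\ge|P_Y(x-p_j)|\}$ satisfies $V_j\cap\overline{E}=\emptyset$. - $(CW^1_X)$ If $(x_j)_j,(z_j)_j$ are sequences in $E$ such that $(P_X(x_j))_j$ is bounded and $\lim_{j\to\infty}\big(f(x_j)-f(z_j)-\langle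 G(z_j),x_j-z_j\rangle\big)=0$, then $\lim_{j\to\infty}|G(x_j)-G(z_j)|=0$. Then there exists a convex Lipschitz function $F:\mathbb{R}^n\to\mathbb{R}$ of class $C^1(\mathbb{R}^n)$ such that $F(x)=f(x)$ and $\nabla F(x)=G(x)$ for all $x\in E$, $X_F=X$, and $$\operatorname{Lip}(F)=\sup_{x\in\mathbb{R}^n}|\nabla F(x)|=\sup_{y\in E}|G(y)|.$$ Here $\operatorname{Lip}(F)$ is the infimum of all $C\ge0$ with $|F(x)-F(y)|\le C|x-y|$ for all $x,y\in\mathbb{R}^n$, and $X_F$ is the unique linear subspace of $\mathbb{R}^n$ for which there are a convex function $c:X_F\to\mathbb{R}$ with $c(x)\to+\infty$ as $|x|\to\infty$ and a vector $v\in\mathbb{R}^n$ such that $F(x)=c(P_{X_F}(x))+\langle v,x\rangle$ for all $x\in\mathbb{R}^n$. -/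

import Mathlib

open Set Filter Topology
open scoped InnerProductSpace Gradient

noncomputable section

/-- The Euclidean space `ℝⁿ`. -/
abbrev Eucl (n : ℕ) : Type := EuclideanSpace ℝ (Fin n)

/-- The optimal Lipschitz constant `Lip(g)` of `g : ℝⁿ → ℝ`, i.e. the infimum of all `C ≥ 0` with
`|g x - g y| ≤ C |x - y|` for all `x, y` (a junk value if `g` is not Lipschitz). -/
def lipConst {n : ℕ} (g : Eucl n → ℝ) : ℝ :=
  sInf {C : ℝ | 0 ≤ C ∧ ∀ x y : Eucl n, |g x - g y| ≤ C * ‖x - y‖}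

/-- `X` is the coercivity subspace `X_F` of `F`: `F = c ∘ P_X + ⟨v, ·⟩` for some convex coercive
`c : X → ℝ` and some vector `v`. There is at most one such `X` for each `F`
(see `IsCoercivitySubspace.unique`). -/
def IsCoercivitySubspace {n : ℕ} (F : Eucl n → ℝ) (X : Submodule ℝ (Eucl n)) : Prop :=
  ∃ (c : X → ℝ) (v : Eucl n),
    ConvexOn ℝ univ c ∧
    Tendsto c (Bornology.cobounded X) atTop ∧
    ∀ x : Eucl n, F x = c (X.orthogonalProjectionOnto x) + ⟪v, x⟫_ℝ

theorem IsCoercivitySubspace.le {n : ℕ} {F : Eucl n → ℝ} {X X' : Submodule ℝ (Eucl n)}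
    (h : IsCoercivitySubspace F X) (h' : IsCoercivitySubspace F X') : X' ≤ X := by
  obtain ⟨c, v, -, -, hc⟩ := h
  obtain ⟨c', v', -, hcoer, hc'⟩ := h'
  rw [← Submodule.orthogonal_le_orthogonal_iff]
  intro u hu
  by_contra hu'
  set q : X' := X'.orthogonalProjectionOnto u with hq
  have hq0 : q ≠ 0 := fun h0 =>
    hu' (by rwa [hq, Submodule.orthogonalProjectionOnto_eq_zero_iff] at h0)
  have hpu : X.orthogonalProjectionOnto u = 0 :=
    Submodule.orthogonalProjectionOnto_eq_zero_iff.2 hu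
  -- along the line through `u`, the function `c'` is affine
  have key : ∀ t : ℝ, c' (t • q) = c 0 + t * (⟪v, u⟫_ℝ - ⟪v', u⟫_ℝ) := by
    intro t
    have h1 := hc (t • u)
    have h2 := hc' (t • u)
    simp only [map_smul, hpu, smul_zero, inner_smul_right] at h1 h2
    rw [← hq] at h2
    linarith
  have hline : Tendsto (fun t : ℝ => t • q) (Bornology.cobounded ℝ)
      (Bornology.cobounded X') := by
    rw [← tendsto_norm_atTop_iff_cobounded]
    simp only [norm_smul]
    exact tendsto_norm_cobounded_atTop.atTop_mul_const (norm_pos_iff.2 hq0)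
  have hev := (hcoer.comp hline).eventually_gt_atTop (c 0)
  have hev' : ∀ᶠ t : ℝ in Bornology.cobounded ℝ, c 0 < c' ((-t) • q) :=
    (tendsto_neg_cobounded).eventually hev
  obtain ⟨t, ht1, ht2⟩ := (hev.and hev').exists
  simp only [Function.comp, key] at ht1 ht2
  linarith

theorem IsCoercivitySubspace.unique {n : ℕ} {F : Eucl n → ℝ} {X X' : Submodule ℝ (Eucl n)}
    (h : IsCoercivitySubspace F X) (h' : IsCoercivitySubspace F X') : X = X' :=
  le_antisymm (h'.le h) (h.le h')

/-- Condition `(C_b)`: `G` is continuous and bounded on `E`, and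
`f x ≥ f y + ⟨G y, x - y⟩` for all `x, y ∈ E`. -/
def CondCb {n : ℕ} {E : Set (Eucl n)} (f : E → ℝ) (G : E → Eucl n) : Prop :=
  Continuous G ∧ Bornology.IsBounded (range G) ∧
    ∀ x y : E, f y + ⟪G y, (x : Eucl n) - y⟫_ℝ ≤ f x

/-- The subspace `Y = span {G x - G y : x, y ∈ E}`. -/
def jetSpan {n : ℕ} {E : Set (Eucl n)} (G : E → Eucl n) : Submodule ℝ (Eucl n) :=
  Submodule.span ℝ {u | ∃ x y : E, u = G x - G y}

/-- The cone `{x : ε ⟨w, x - p⟩ ≥ |P_Y (x - p)|}`. -/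
def cone {n : ℕ} (Y : Submodule ℝ (Eucl n)) (ε : ℝ) (w p : Eucl n) : Set (Eucl n) :=
  {x | ‖Y.orthogonalProjectionOnto (x - p)‖ ≤ ε * ⟪w, x - p⟫_ℝ}

/-- Condition `(S_{Y,X})`: `Y ⊆ X`. -/
def CondS {n : ℕ} {E : Set (Eucl n)} (G : E → Eucl n) (X : Submodule ℝ (Eucl n)) : Prop :=
  jetSpan G ≤ X

/-- Condition `(C_{Y,X})`: if `Y ≠ X`, there are `d - k = dim X - dim Y` points `p j` outside the
closure of `E`, a number `ε ∈ (0,1)` and linearly independent unit vectors `w j ∈ X ∩ Yᗮ` such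
that the corresponding cones do not meet the closure of `E`. (It is used together with `Y ⊆ X`, so
the subtraction of dimensions is the true one.) -/
def CondCone {n : ℕ} {E : Set (Eucl n)} (G : E → Eucl n) (X : Submodule ℝ (Eucl n)) : Prop :=
  jetSpan G ≠ X →
    ∃ (p : Fin (Module.finrank ℝ X - Module.finrank ℝ (jetSpan G)) → Eucl n) (ε : ℝ)
      (w : Fin (Module.finrank ℝ X - Module.finrank ℝ (jetSpan G)) → Eucl n),
      (∀ j, p j ∉ closure E) ∧
      0 < ε ∧ ε < 1 ∧
      LinearIndependent ℝ w ∧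
      (∀ j, ‖w j‖ = 1) ∧
      (∀ j, w j ∈ X ⊓ (jetSpan G)ᗮ) ∧
      ∀ j, cone (jetSpan G) ε (w j) (p j) ∩ closure E = ∅

/-- Condition `(CW¹_X)`: no corners at infinity in directions orthogonal to `X`. -/
def CondCW {n : ℕ} {E : Set (Eucl n)} (f : E → ℝ) (G : E → Eucl n)
    (X : Submodule ℝ (Eucl n)) : Prop :=
  ∀ x z : ℕ → E,
    Bornology.IsBounded (range fun j => X.orthogonalProjectionOnto (x j : Eucl n)) →
    Tendsto (fun j => f (x j) - f (z j) - ⟪G (z j), (x j : Eucl n) - z j⟫_ℝ) atTop (𝓝 0) →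
    Tendsto (fun j => ‖G (x j) - G (z j)‖) atTop (𝓝 0)

end

/-! Let `M = sup |G|`. The extension `F` is the largest convex `M`-Lipschitz function lying below a
family of upper functions `A y`, one for each `y ∈ E`, that touch the data at `y`. It is squeezed
from below by affine minorants with slopes of norm at most `M`.

The minorants are the tangents of the jets and, for each cone direction `w j`, a tilted function of
slope `v + δ w j`. Finitely many tangents already grow like `⟨v, x⟩ + c |P_Y x|`, and the cone
condition lets this growth pay for the tilt. Since `G` is not constant, `|v| < M` leaves room for
it. Together the slopes see every direction of `X`, so the minorants are coercive along `X`
(`exists_affine_add_norm_proj_le`).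

By `(CW¹_X)`, a minorant that almost touches the data at `y` has slope near `G y`, uniformly while
`P_X y` is bounded. Hence its excess over the tangent at `y` is uniformly `o(|u|)` and has one
smooth majorant `ψ` (`exists_smooth_majorant`). Adding `ψ` and a square to the tangent gives `A y`.

Near-optimal convex combinations for `F` at `x` put at least half of their weight on `y` with
bounded `P_X y`. Moving only those terms bounds the second differences of `F`
(`smoothAboveOn_lipEnvelope`), which for a convex function gives differentiability, hence `C¹`.
Between `A y` and the tangent, `F` has value `f y` and gradient `G y` at `y`. As each `A y` is
affine with one common slope along `Xᗮ`, so is `F`. -/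

/-! ### Subgradients and differentiability of convex functions. -/

section Convex

variable {V : Type*} [NormedAddCommGroup V] [InnerProductSpace ℝ V]

/-- A continuous convex function has a subgradient at every point. -/
theorem ConvexOn.exists_subgradient [CompleteSpace V] {F : V → ℝ} (hF : ConvexOn ℝ univ F)
    (hc : Continuous F) (x : V) : ∃ p : V, ∀ y, F x + ⟪p, y - x⟫_ℝ ≤ F y := by
  obtain ⟨φ, hφ⟩ := geometric_hahn_banach_open_point (s := {q : V × ℝ | q.1 ∈ univ ∧ F q.1 < q.2})
    (x := (x, F x)) hF.convex_strict_epigraph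
    (by simpa using isOpen_lt (hc.comp continuous_fst) continuous_snd) (by simp)
  have hdec : ∀ y t, φ (y, t) = φ (y, 0) + t * φ (0, 1) := by
    intro y t
    have : ((y, t) : V × ℝ) = (y, 0) + t • ((0 : V), (1 : ℝ)) := by simp
    rw [this, map_add, map_smul, smul_eq_mul]
  set s := φ (0, 1) with hs
  have h1 : s < 0 := by
    have := hφ (x, F x + 1) (by simp)
    rw [hdec, hdec x (F x)] at this
    linarith
  set l : V →L[ℝ] ℝ := φ.comp (ContinuousLinearMap.inl ℝ V ℝ) with hl
  -- If this failed, the functional would take its value at `(x, F x)` at some point strictly above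
  -- `(y, F y)`, against strict separation.
  have hle : ∀ y, φ (y, 0) + F y * s ≤ φ (x, 0) + F x * s := by
    intro y
    by_contra! hlt
    have hpos : 0 < (φ (y, 0) + F y * s - (φ (x, 0) + F x * s)) / (-s) :=
      div_pos (by linarith) (by linarith)
    have := hφ (y, F y + (φ (y, 0) + F y * s - (φ (x, 0) + F x * s)) / (-s)) (by simpa using hpos)
    rw [hdec, hdec x (F x), add_mul] at this
    have h2 : (φ (y, 0) + F y * s - (φ (x, 0) + F x * s)) / (-s) * s
        = -(φ (y, 0) + F y * s - (φ (x, 0) + F x * s)) := by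
      field_simp [h1.ne]
    linarith
  refine ⟨(InnerProductSpace.toDual ℝ V).symm ((-s⁻¹) • l), fun y => ?_⟩
  rw [InnerProductSpace.toDual_symm_apply]
  have h3 : l (y - x) = φ (y, 0) - φ (x, 0) := by rw [map_sub]; simp [hl]
  have h4 := hle y
  simp only [_root_.smul_apply, smul_eq_mul, h3]
  have h5 : -s⁻¹ * (φ (y, 0) - φ (x, 0)) ≤ F y - F x := by
    rw [neg_mul, ← div_eq_inv_mul, ← neg_div_neg_eq, ← neg_div, div_le_iff₀ (by linarith)]
    linarith
  linarith

/-- The second symmetric differences of `ψ` at the points of `s` are bounded above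
by `ε ‖h‖ + C ‖h‖ ^ 2`, for every `ε > 0` and a suitable `C` depending on `ε`. -/
def SmoothAboveOn (ψ : V → ℝ) (s : Set V) : Prop :=
  ∀ ε > 0, ∃ C : ℝ, 0 ≤ C ∧ ∀ x ∈ s, ∀ h,
    ψ (x + h) + ψ (x - h) - 2 * ψ x ≤ ε * ‖h‖ + C * ‖h‖ ^ 2

/-- The first-order remainders at `h` and `-h` are both nonnegative and add up to the second
difference, so each is bounded by it. -/
theorem SmoothAboveOn.hasGradientAt [CompleteSpace V] {F : V → ℝ} {x p : V}
    (hF : SmoothAboveOn F {x}) (hp : ∀ y, F x + ⟪p, y - x⟫_ℝ ≤ F y) : HasGradientAt F p x := by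
  rw [hasGradientAt_iff_isLittleO_nhds_zero, Asymptotics.isLittleO_iff]
  intro ε hε
  obtain ⟨C, hC, h⟩ := hF (ε / 2) (by positivity)
  have hb : Metric.ball (0 : V) (ε / (2 * (C + 1))) ∈ 𝓝 (0 : V) :=
    Metric.ball_mem_nhds _ (by positivity)
  filter_upwards [hb] with k hk
  rw [mem_ball_zero_iff, lt_div_iff₀ (by positivity)] at hk
  have h1 := hp (x + k)
  have h2 := hp (x - k)
  have h3 := h x rfl k
  simp only [add_sub_cancel_left, sub_sub_cancel_left, inner_neg_right] at h1 h2
  rw [Real.norm_eq_abs, abs_of_nonneg (by linarith)]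
  nlinarith [norm_nonneg k, mul_nonneg hC (norm_nonneg k)]

/-- A Lipschitz convex function that is differentiable everywhere is of class `C¹`. -/
theorem contDiff_one_of_hasGradientAt [CompleteSpace V] {F : V → ℝ} {g : V → V} {M : ℝ}
    (hL : ∀ x y, |F x - F y| ≤ M * ‖x - y‖) (hsub : ∀ x y, F x + ⟪g x, y - x⟫_ℝ ≤ F y)
    (hg : ∀ x, HasGradientAt F (g x) x) : ContDiff ℝ 1 F := by
  have hcont : Continuous g := by
    rw [continuous_iff_continuousAt]
    intro x
    rw [Metric.continuousAt_iff]
    intro ε hε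
    have hx := hg x
    rw [hasGradientAt_iff_isLittleO_nhds_zero, Asymptotics.isLittleO_iff] at hx
    obtain ⟨δ, hδ, hball⟩ := Metric.eventually_nhds_iff.1 (hx (c := ε / 4) (by positivity))
    refine ⟨ε * δ / (16 * (|M| + 1)), by positivity, fun {y} hy => ?_⟩
    rw [dist_eq_norm] at hy ⊢
    by_contra! hge
    have hpos : 0 < ‖g y - g x‖ := lt_of_lt_of_le hε hge
    -- Test displacement of length `δ / 2` along `g y - g x`: the subgradient inequality at `y`
    -- against the expansion at `x` gives `‖g y - g x‖ ≤ ε / 2`.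
    set k : V := (δ / 2 / ‖g y - g x‖) • (g y - g x) with hk
    have hkn : ‖k‖ = δ / 2 := by
      rw [hk, norm_smul, Real.norm_of_nonneg (by positivity)]
      field_simp
    have h1 := hball (y := k) (by rw [dist_zero_right, hkn]; linarith)
    rw [hkn] at h1
    have h1' := le_of_abs_le h1
    have h2 := hsub y (y + k)
    have h3 := le_of_abs_le (hL (y + k) (x + k))
    have h4 := neg_le_of_abs_le (hL y x)
    rw [add_sub_add_right_eq_sub] at h3
    rw [add_sub_cancel_left] at h2
    have h5 : ⟪g y, k⟫_ℝ - ⟪g x, k⟫_ℝ = δ / 2 * ‖g y - g x‖ := by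
      rw [← inner_sub_left, hk, inner_smul_right, real_inner_self_eq_norm_sq]
      field_simp
    have h6 : M * ‖y - x‖ ≤ ε * δ / 16 := by
      calc M * ‖y - x‖ ≤ (|M| + 1) * (ε * δ / (16 * (|M| + 1))) := by
            gcongr
            linarith [le_abs_self M]
        _ = _ := by field_simp
    nlinarith
  rw [contDiff_one_iff_fderiv]
  refine ⟨fun x => (hg x).differentiableAt, ?_⟩
  have : fderiv ℝ F = fun x => InnerProductSpace.toDual ℝ V (g x) :=
    funext fun x => (hg x).hasFDerivAt.fderiv
  rw [this]
  exact (InnerProductSpace.toDual ℝ V).continuous.comp hcont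

/-! ### The convex Lipschitz envelope. -/

/-- The largest convex `M`-Lipschitz function whose epigraph contains `S`. -/
noncomputable def lipEnvelope (M : ℝ) (S : Set (V × ℝ)) (x : V) : ℝ :=
  ⨅ q : convexHull ℝ S, (q : V × ℝ).2 + M * ‖x - (q : V × ℝ).1‖

section lipEnvelope

variable {M : ℝ} {S : Set (V × ℝ)} {L : V → ℝ}

theorem le_of_mem_convexHull (hL : ConvexOn ℝ univ L) (hS : ∀ q ∈ S, L q.1 ≤ q.2) {q : V × ℝ}
    (hq : q ∈ convexHull ℝ S) : L q.1 ≤ q.2 :=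
  (convexHull_min (t := {p | p.1 ∈ univ ∧ L p.1 ≤ p.2}) (fun q hq => ⟨mem_univ _, hS q hq⟩)
    hL.convex_epigraph hq).2

/-- Convexity carries the bound to the hull and the Lipschitz property carries it through the
infimal convolution. One such `L` keeps all the infima bounded below, hence its presence in the
lemmas on `lipEnvelope`. -/
theorem le_of_mem_convexHull_add (hL : ConvexOn ℝ univ L)
    (hLip : ∀ x y, L x - L y ≤ M * ‖x - y‖)
    (hS : ∀ q ∈ S, L q.1 ≤ q.2) {q : V × ℝ} (hq : q ∈ convexHull ℝ S) (x : V) :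
    L x ≤ q.2 + M * ‖x - q.1‖ := by
  linarith [le_of_mem_convexHull hL hS hq, hLip x q.1]

theorem bddBelow_lipEnvelope (hL : ConvexOn ℝ univ L) (hLip : ∀ x y, L x - L y ≤ M * ‖x - y‖)
    (hS : ∀ q ∈ S, L q.1 ≤ q.2) (x : V) :
    BddBelow (range fun q : convexHull ℝ S => (q : V × ℝ).2 + M * ‖x - (q : V × ℝ).1‖) := by
  refine ⟨L x, ?_⟩
  rintro _ ⟨q, rfl⟩
  exact le_of_mem_convexHull_add hL hLip hS q.2 x

theorem le_lipEnvelope (hne : S.Nonempty) (hL : ConvexOn ℝ univ L)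
    (hLip : ∀ x y, L x - L y ≤ M * ‖x - y‖)
    (hS : ∀ q ∈ S, L q.1 ≤ q.2) (x : V) : L x ≤ lipEnvelope M S x := by
  have : Nonempty (convexHull ℝ S) := (hne.mono (subset_convexHull ℝ S)).to_subtype
  exact le_ciInf fun q => le_of_mem_convexHull_add hL hLip hS q.2 x

theorem lipEnvelope_le_of_mem (hL : ConvexOn ℝ univ L) (hLip : ∀ x y, L x - L y ≤ M * ‖x - y‖)
    (hS : ∀ q ∈ S, L q.1 ≤ q.2) {q : V × ℝ} (hq : q ∈ convexHull ℝ S) (x : V) :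
    lipEnvelope M S x ≤ q.2 + M * ‖x - q.1‖ :=
  ciInf_le (bddBelow_lipEnvelope hL hLip hS x) (⟨q, hq⟩ : convexHull ℝ S)

theorem exists_mem_lt_lipEnvelope_add (hne : S.Nonempty) (x : V) {η : ℝ} (hη : 0 < η) :
    ∃ q ∈ convexHull ℝ S, q.2 + M * ‖x - q.1‖ < lipEnvelope M S x + η := by
  have : Nonempty (convexHull ℝ S) := (hne.mono (subset_convexHull ℝ S)).to_subtype
  obtain ⟨q, hq⟩ := exists_lt_of_ciInf_lt (lt_add_of_pos_right (lipEnvelope M S x) hη)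
  exact ⟨q, q.2, hq⟩

theorem convexOn_lipEnvelope (hM : 0 ≤ M) (hne : S.Nonempty) (hL : ConvexOn ℝ univ L)
    (hLip : ∀ x y, L x - L y ≤ M * ‖x - y‖) (hS : ∀ q ∈ S, L q.1 ≤ q.2) :
    ConvexOn ℝ univ (lipEnvelope M S) := by
  refine ⟨convex_univ, fun x _ y _ a b ha hb hab => le_of_forall_pos_le_add fun η hη => ?_⟩
  obtain ⟨q, hq, hqx⟩ := exists_mem_lt_lipEnvelope_add (M := M) hne x hη
  obtain ⟨r, hr, hry⟩ := exists_mem_lt_lipEnvelope_add (M := M) hne y hη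
  have h1 := lipEnvelope_le_of_mem hL hLip hS
    (convex_convexHull ℝ S hq hr ha hb hab) (a • x + b • y)
  have h2 : ‖a • x + b • y - (a • q + b • r).1‖ ≤ a * ‖x - q.1‖ + b * ‖y - r.1‖ := by
    calc _ = ‖a • (x - q.1) + b • (y - r.1)‖ := by
          congr 1
          simp only [Prod.fst_add, Prod.smul_fst]
          module
      _ ≤ _ := by
          refine (norm_add_le _ _).trans_eq ?_
          rw [norm_smul, norm_smul, Real.norm_of_nonneg ha, Real.norm_of_nonneg hb]
  have h3 := mul_le_mul_of_nonneg_left h2 hM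
  have h4 := mul_le_mul_of_nonneg_left hqx.le ha
  have h5 := mul_le_mul_of_nonneg_left hry.le hb
  simp only [Prod.snd_add, Prod.smul_snd, smul_eq_mul] at h1 ⊢
  have h6 : a * η + b * η = η := by rw [← add_mul, hab, one_mul]
  linarith

theorem lipEnvelope_sub_le (hM : 0 ≤ M) (hne : S.Nonempty) (hL : ConvexOn ℝ univ L)
    (hLip : ∀ x y, L x - L y ≤ M * ‖x - y‖) (hS : ∀ q ∈ S, L q.1 ≤ q.2) (x y : V) :
    lipEnvelope M S x - lipEnvelope M S y ≤ M * ‖x - y‖ := by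
  refine le_of_forall_pos_le_add fun η hη => ?_
  obtain ⟨q, hq, hqy⟩ := exists_mem_lt_lipEnvelope_add (M := M) hne y hη
  have h1 := lipEnvelope_le_of_mem hL hLip hS hq x
  have h2 := mul_le_mul_of_nonneg_left (norm_sub_le_norm_sub_add_norm_sub x y q.1) hM
  linarith

/-- A translation that maps `S` into itself maps its hull into itself. Using it for `u` and `-u`
makes the envelope affine in the direction `u`. -/
theorem lipEnvelope_add_le (hne : S.Nonempty) (hL : ConvexOn ℝ univ L)
    (hLip : ∀ x y, L x - L y ≤ M * ‖x - y‖) (hS : ∀ q ∈ S, L q.1 ≤ q.2) {u : V} {s : ℝ}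
    (hu : ∀ q ∈ S, q + (u, s) ∈ S) (x : V) :
    lipEnvelope M S (x + u) ≤ lipEnvelope M S x + s := by
  refine le_of_forall_pos_le_add fun η hη => ?_
  obtain ⟨q, hq, hqx⟩ := exists_mem_lt_lipEnvelope_add (M := M) hne x hη
  have hsub : convexHull ℝ S ⊆ (fun q => q + (u, s)) ⁻¹' convexHull ℝ S :=
    convexHull_min (fun p hp => subset_convexHull ℝ S (hu p hp))
      ((convex_convexHull ℝ S).translate_preimage_left _)
  have h1 := lipEnvelope_le_of_mem hL hLip hS (hsub hq) (x + u)
  simp only [Prod.fst_add, Prod.snd_add, add_sub_add_right_eq_sub] at h1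
  linarith

/-- If upper functions `A i` dominate a fixed affine function by at least `q i` and have uniformly
small second differences on each sublevel set of `q`, then their envelope has small second
differences at every point. -/
theorem smoothAboveOn_lipEnvelope {ι : Type*} [Nonempty ι] {A : ι → V → ℝ} {q : ι → ℝ} {v : V}
    {c : ℝ} (hv : ‖v‖ ≤ M) (hq : ∀ i, 0 ≤ q i) (hA : ∀ i a, ⟪v, a⟫_ℝ + q i - c ≤ A i a)
    (hs : ∀ R, ∀ ε > 0, ∃ C : ℝ, 0 ≤ C ∧ ∀ i, q i ≤ R → ∀ a h,
      A i (a + h) + A i (a - h) - 2 * A i a ≤ ε * ‖h‖ + C * ‖h‖ ^ 2) (x : V) :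
    SmoothAboveOn (lipEnvelope M {p | ∃ i, p.2 = A i p.1}) {x} := by
  set S : Set (V × ℝ) := {p | ∃ i, p.2 = A i p.1} with hSdef
  have hM : 0 ≤ M := (norm_nonneg v).trans hv
  have hvM : ∀ z, ⟪v, z⟫_ℝ ≤ M * ‖z‖ := fun z =>
    (real_inner_le_norm v z).trans (mul_le_mul_of_nonneg_right hv (norm_nonneg z))
  have hne : S.Nonempty := ⟨(0, A (Classical.arbitrary ι) 0), _, rfl⟩
  have hL : ConvexOn ℝ univ fun z : V => ⟪v, z⟫_ℝ - c :=
    ((innerₛₗ ℝ v).convexOn convex_univ).sub (concaveOn_const c convex_univ)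
  have hLip : ∀ y z : V, (⟪v, y⟫_ℝ - c) - (⟪v, z⟫_ℝ - c) ≤ M * ‖y - z‖ := fun y z => by
    rw [sub_sub_sub_cancel_right, ← inner_sub_right]
    exact hvM _
  have hS : ∀ p ∈ S, ⟪v, p.1⟫_ℝ - c ≤ p.2 := by
    rintro p ⟨i, hi⟩
    rw [hi]
    linarith [hA i p.1, hq i]
  intro ε hε
  set T := lipEnvelope M S x + 1 - ⟪v, x⟫_ℝ + c with hT
  have hT1 : 1 ≤ T := by linarith [le_lipEnvelope hne hL hLip hS x]
  obtain ⟨C, hC, hsC⟩ := hs (2 * T) ε hε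
  -- `2 * C` comes from displacements of at most `2 ‖h‖`, and the other `2` from choosing a
  -- combination optimal up to `‖h‖ ^ 2`.
  refine ⟨2 * C + 2, by positivity, ?_⟩
  intro y hy h
  rw [mem_singleton_iff.1 hy]
  rcases eq_or_ne h 0 with rfl | hh
  · simp [two_mul]
  have hhpos : 0 < ‖h‖ := norm_pos_iff.2 hh
  obtain ⟨p, hp, hpx⟩ := exists_mem_lt_lipEnvelope_add (M := M) hne x
    (lt_min one_pos (pow_pos hhpos 2))
  obtain ⟨κ, _, w, z, hw0, hw1, hzS, rfl⟩ := mem_convexHull_iff_exists_fintype.1 hp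
  choose e he using hzS
  classical
  set P : V := (∑ i, w i • z i).1 with hP
  have hP' : P = ∑ i, w i • (z i).1 := by rw [hP, Prod.fst_sum]; rfl
  have hsnd : (∑ i, w i • z i).2 = ∑ i, w i * A (e i) (z i).1 := by
    rw [Prod.snd_sum]
    exact Finset.sum_congr rfl fun i _ => by rw [Prod.smul_snd, he, smul_eq_mul]
  rw [hsnd] at hpx
  have hmean : ∑ i, w i * q (e i) ≤ T := by
    have h1 : ∑ i, w i * (⟪v, (z i).1⟫_ℝ + q (e i) - c) ≤ ∑ i, w i * A (e i) (z i).1 :=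
      Finset.sum_le_sum fun i _ => mul_le_mul_of_nonneg_left (hA _ _) (hw0 i)
    have h2 : ∑ i, w i * (⟪v, (z i).1⟫_ℝ + q (e i) - c)
        = ⟪v, P⟫_ℝ + ∑ i, w i * q (e i) - c := by
      simp only [mul_sub, mul_add, Finset.sum_sub_distrib, Finset.sum_add_distrib,
        ← Finset.sum_mul, hw1, one_mul, hP', inner_sum, inner_smul_right]
    have h3 := hvM (x - P)
    rw [inner_sub_right] at h3
    linarith [min_le_left 1 (‖h‖ ^ 2)]
  -- By Markov's inequality, the terms with `q ≤ 2 * T` carry at least half of the weight.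
  set Λ := ∑ i, w i * (if q (e i) ≤ 2 * T then 1 else 0) with hΛ
  have hΛhalf : 1 / 2 ≤ Λ := by
    have h1 : ∑ i, w i * (2 * T * (1 - if q (e i) ≤ 2 * T then 1 else 0))
        ≤ ∑ i, w i * q (e i) := by
      refine Finset.sum_le_sum fun i _ => mul_le_mul_of_nonneg_left ?_ (hw0 i)
      split_ifs with hi
      · simpa using hq (e i)
      · linarith
    have h2 : ∑ i, w i * (2 * T * (1 - if q (e i) ≤ 2 * T then 1 else 0))
        = 2 * T * (1 - Λ) := by
      simp only [mul_sub, mul_one, Finset.sum_sub_distrib, ← Finset.sum_mul, hw1, one_mul, hΛ,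
        Finset.mul_sum]
      congr 1
      exact Finset.sum_congr rfl fun i _ => by ring
    nlinarith
  have hΛpos : 0 < Λ := by linarith
  -- Only the controlled terms move, each by `Λ⁻¹ • k`, so that the barycentre moves by exactly `k`.
  set d : κ → ℝ := fun i => Λ⁻¹ * if q (e i) ≤ 2 * T then 1 else 0 with hd
  have hd1 : ∑ i, w i * d i = 1 := by
    rw [← inv_mul_cancel₀ hΛpos.ne']
    nth_rewrite 2 [hΛ]
    rw [Finset.mul_sum]
    exact Finset.sum_congr rfl fun i _ => by simp only [hd]; ring
  have hd0 : ∀ i, 0 ≤ d i := fun i => by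
    simp only [hd]
    split_ifs <;> simp [hΛpos.le]
  have hd2 : ∀ i, d i ≤ 2 := fun i => by
    have : Λ⁻¹ ≤ 2 := by
      rw [inv_le_comm₀ hΛpos two_pos]
      linarith
    simp only [hd]
    split_ifs <;> linarith
  have key : ∀ k, lipEnvelope M S (x + k)
      ≤ ∑ i, w i * A (e i) ((z i).1 + d i • k) + M * ‖x - P‖ := by
    intro k
    have hmem : ∑ i, w i • ((z i).1 + d i • k, A (e i) ((z i).1 + d i • k)) ∈ convexHull ℝ S :=
      (convex_convexHull ℝ S).sum_mem (fun i _ => hw0 i) hw1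
        fun i _ => subset_convexHull ℝ S ⟨e i, rfl⟩
    have h1 := lipEnvelope_le_of_mem hL hLip hS hmem (x + k)
    have h2 : (∑ i, w i • ((z i).1 + d i • k, A (e i) ((z i).1 + d i • k))).1 = P + k := by
      rw [Prod.fst_sum, hP']
      simp only [Prod.smul_fst, smul_add, Finset.sum_add_distrib, smul_smul, ← Finset.sum_smul,
        hd1, one_smul]
    rw [h2, Prod.snd_sum, add_sub_add_right_eq_sub] at h1
    simpa using h1
  have hplus := key h
  have hminus := key (-h)
  rw [← sub_eq_add_neg] at hminus
  have hdiff : ∑ i, w i * A (e i) ((z i).1 + d i • h) + ∑ i, w i * A (e i) ((z i).1 + d i • -h)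
      - 2 * ∑ i, w i * A (e i) (z i).1 ≤ ε * ‖h‖ + 2 * C * ‖h‖ ^ 2 := by
    calc _ = ∑ i, w i * (A (e i) ((z i).1 + d i • h) + A (e i) ((z i).1 - d i • h)
          - 2 * A (e i) (z i).1) := by
          rw [Finset.mul_sum, ← Finset.sum_add_distrib, ← Finset.sum_sub_distrib]
          refine Finset.sum_congr rfl fun i _ => ?_
          rw [smul_neg, ← sub_eq_add_neg]
          ring
      _ ≤ ∑ i, w i * d i * (ε * ‖h‖ + 2 * C * ‖h‖ ^ 2) := by
          refine Finset.sum_le_sum fun i _ => ?_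
          rw [mul_assoc]
          refine mul_le_mul_of_nonneg_left ?_ (hw0 i)
          by_cases hi : q (e i) ≤ 2 * T
          · refine (hsC (e i) hi (z i).1 (d i • h)).trans ?_
            rw [norm_smul, Real.norm_of_nonneg (hd0 i)]
            have := mul_le_mul_of_nonneg_left (hd2 i) (mul_nonneg hC (hd0 i))
            nlinarith [sq_nonneg ‖h‖]
          · have : d i = 0 := by simp [hd, hi]
            simp [this, two_mul]
      _ = _ := by rw [← Finset.sum_mul, hd1, one_mul]
  linarith [min_le_right 1 (‖h‖ ^ 2)]

end lipEnvelope

end Convex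

/-! ### Smooth majorants of uniformly `o(‖u‖)` errors. -/

section Majorant

variable {V : Type*} [NormedAddCommGroup V]

/-- A smooth approximation of the norm, of size `‖u‖` at scales larger than `δ`. -/
noncomputable def smoothNorm (δ : ℝ) (u : V) : ℝ := √(‖u‖ ^ 2 + δ ^ 2) - δ

theorem smoothNorm_zero {δ : ℝ} (hδ : 0 ≤ δ) : smoothNorm δ (0 : V) = 0 := by
  simp [smoothNorm, Real.sqrt_sq hδ]

theorem smoothNorm_nonneg (δ : ℝ) (u : V) : 0 ≤ smoothNorm δ u :=
  sub_nonneg.2 (Real.le_sqrt_of_sq_le (by nlinarith [sq_nonneg ‖u‖]))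

theorem smoothNorm_le {δ : ℝ} (hδ : 0 ≤ δ) (u : V) : smoothNorm δ u ≤ ‖u‖ := by
  rw [smoothNorm, sub_le_iff_le_add, Real.sqrt_le_left (by positivity)]
  nlinarith [mul_nonneg hδ (norm_nonneg u)]

theorem norm_le_three_mul_smoothNorm {δ : ℝ} (hδ : 0 ≤ δ) {u : V} (hu : δ ≤ ‖u‖) :
    ‖u‖ ≤ 3 * smoothNorm δ u := by
  have : ‖u‖ / 3 + δ ≤ √(‖u‖ ^ 2 + δ ^ 2) := by
    apply Real.le_sqrt_of_sq_le
    nlinarith [norm_nonneg u]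
  rw [smoothNorm]
  linarith

theorem smoothNorm_add_le (δ : ℝ) (u h : V) :
    smoothNorm δ (u + h) ≤ smoothNorm δ u + ‖h‖ := by
  rw [smoothNorm, smoothNorm, sub_add_eq_add_sub, sub_le_sub_iff_right,
    Real.sqrt_le_left (by positivity)]
  have h1 := norm_add_le u h
  have h2 : ‖u‖ ≤ √(‖u‖ ^ 2 + δ ^ 2) := Real.le_sqrt_of_sq_le (by nlinarith)
  have h3 := Real.sq_sqrt (show 0 ≤ ‖u‖ ^ 2 + δ ^ 2 by positivity)
  nlinarith [norm_nonneg h, norm_nonneg (u + h), norm_nonneg u,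
    mul_le_mul_of_nonneg_left h2 (norm_nonneg h)]

variable [InnerProductSpace ℝ V]

/-- With `a`, `b`, `r` the square roots at `u + h`, `u - h`, `u`, the parallelogram law gives `(a +
b)² ≤ 4r² + 4‖h‖² ≤ (2r + ‖h‖² / r)²`, and `r ≥ δ`. -/
theorem smoothNorm_second_diff_le {δ : ℝ} (hδ : 0 < δ) (u h : V) :
    smoothNorm δ (u + h) + smoothNorm δ (u - h) - 2 * smoothNorm δ u ≤ δ⁻¹ * ‖h‖ ^ 2 := by
  simp only [smoothNorm]
  have hpar := parallelogram_law_with_norm ℝ u h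
  set a := √(‖u + h‖ ^ 2 + δ ^ 2)
  set b := √(‖u - h‖ ^ 2 + δ ^ 2)
  set r := √(‖u‖ ^ 2 + δ ^ 2)
  have ha : a ^ 2 = ‖u + h‖ ^ 2 + δ ^ 2 := Real.sq_sqrt (by positivity)
  have hb : b ^ 2 = ‖u - h‖ ^ 2 + δ ^ 2 := Real.sq_sqrt (by positivity)
  have hr : r ^ 2 = ‖u‖ ^ 2 + δ ^ 2 := Real.sq_sqrt (by positivity)
  have hrδ : δ ≤ r := Real.le_sqrt_of_sq_le (by nlinarith [sq_nonneg ‖u‖])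
  have hrpos : 0 < r := hδ.trans_le hrδ
  have h1 : a + b ≤ 2 * r + r⁻¹ * ‖h‖ ^ 2 := by
    refine le_of_abs_le (abs_le_of_sq_le_sq ?_ (by positivity))
    have h2 : (2 * r + r⁻¹ * ‖h‖ ^ 2) ^ 2 = 4 * r ^ 2 + 4 * ‖h‖ ^ 2 + (r⁻¹ * ‖h‖ ^ 2) ^ 2 := by
      field_simp
      ring
    nlinarith [sq_nonneg (a - b), sq_nonneg (r⁻¹ * ‖h‖ ^ 2)]
  have h3 : r⁻¹ * ‖h‖ ^ 2 ≤ δ⁻¹ * ‖h‖ ^ 2 := by gcongr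
  linarith

/-- A family of errors that is uniformly `O(‖u‖)`, and uniformly `o(‖u‖)` at the origin, has a
common majorant vanishing at the origin with uniformly small second differences. -/
theorem exists_smooth_majorant {ι : Type*} {W : ι → V → ℝ} {B : ℝ} (hB : 0 ≤ B)
    (hWB : ∀ i u, W i u ≤ B * ‖u‖)
    (hW : ∀ ε > 0, ∃ δ > 0, ∀ i u, ‖u‖ ≤ δ → W i u ≤ ε * ‖u‖) :
    ∃ ψ : V → ℝ, ψ 0 = 0 ∧ (∀ u, 0 ≤ ψ u) ∧ (∀ i u, W i u ≤ ψ u) ∧ SmoothAboveOn ψ univ := by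
  set a : ℕ → ℝ := fun j => (B + 1) * (1 / 2) ^ j with ha
  have hapos : ∀ j, 0 < a j := fun j => by positivity
  have hasum : Summable a := summable_geometric_two.mul_left _
  -- The bound inside radius `δ j` uses the next coefficient: if `j + 1` is the first index whose
  -- radius is at most `‖u‖`, then `‖u‖ < δ j`, and term `j + 1` alone must dominate the error. The
  -- cap `(1 / 2) ^ j` makes such an index exist.
  have hδ' : ∀ j, ∃ δ > 0, δ ≤ (1 / 2 : ℝ) ^ j ∧ ∀ i u, ‖u‖ ≤ δ → W i u ≤ a (j + 1) * ‖u‖ := by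
    intro j
    obtain ⟨δ, hδ, h⟩ := hW (a (j + 1)) (hapos _)
    exact ⟨min δ ((1 / 2) ^ j), lt_min hδ (by positivity), min_le_right _ _,
      fun i u hu => h i u (hu.trans (min_le_left _ _))⟩
  choose δ hδ hδle hδW using hδ'
  set t : ℕ → V → ℝ := fun j u => a j * (3 * smoothNorm (δ j) u) with ht
  have ht0 : ∀ j u, 0 ≤ t j u := fun j u =>
    mul_nonneg (hapos j).le (mul_nonneg (by norm_num) (smoothNorm_nonneg (δ j) u))
  have hts : ∀ u, Summable fun j => t j u := fun u =>
    Summable.of_nonneg_of_le (fun j => ht0 j u) (fun j => by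
      have := smoothNorm_le (hδ j).le u
      exact mul_le_mul_of_nonneg_left (by linarith) (hapos j).le) (hasum.mul_right (3 * ‖u‖))
  refine ⟨fun u => ∑' j, t j u, ?_, fun u => tsum_nonneg fun j => ht0 j u, fun i u => ?_, ?_⟩
  · simp [ht, smoothNorm_zero (hδ _).le]
  · rcases eq_or_ne u 0 with rfl | hu
    · refine (hWB i 0).trans ?_
      simpa using tsum_nonneg fun j => ht0 j (0 : V)
    have hu' : 0 < ‖u‖ := norm_pos_iff.2 hu
    have hex : ∃ j, δ j ≤ ‖u‖ := by
      obtain ⟨j, hj⟩ := exists_pow_lt_of_lt_one hu' (by norm_num : (1 / 2 : ℝ) < 1)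
      exact ⟨j, (hδle j).trans hj.le⟩
    classical
    have hle : W i u ≤ a (Nat.find hex) * ‖u‖ := by
      rcases h : Nat.find hex with _ | m
      · refine (hWB i u).trans ?_
        simp only [ha, pow_zero, mul_one]
        nlinarith
      · exact hδW m i u (not_le.1 (Nat.find_min hex (m := m) (by omega))).le
    have h1 : t (Nat.find hex) u ≤ ∑' j, t j u := (hts u).le_tsum _ fun j _ => ht0 j u
    refine hle.trans (le_trans ?_ h1)
    exact mul_le_mul_of_nonneg_left
      (norm_le_three_mul_smoothNorm (hδ _).le (Nat.find_spec hex)) (hapos _).le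
  · intro ε hε
    -- The first `N` terms have quadratic second differences. In the tail only the Lipschitz bound
    -- is used: `3 * smoothNorm` has second differences at most `6 ‖h‖`, hence `ε / 6`.
    obtain ⟨N, hN⟩ := (((hasum.hasSum.tendsto_sum_nat).const_sub (∑' j, a j)).eventually_lt_const
      (u := ε / 6) (by rw [sub_self]; positivity)).exists
    refine ⟨∑ j ∈ Finset.range N, a j * (3 * (δ j)⁻¹),
      Finset.sum_nonneg fun j _ => by have := hapos j; have := hδ j; positivity, fun x _ h => ?_⟩
    have hsum := (((hts (x + h)).add (hts (x - h))).sub ((hts x).mul_left 2))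
    have htail : ∑' j, a (j + N) ≤ ε / 6 := by
      have := hasum.sum_add_tsum_nat_add N
      linarith
    calc _ = ∑' j, (t j (x + h) + t j (x - h) - 2 * t j x) := by
          rw [Summable.tsum_sub ((hts (x + h)).add (hts (x - h))) ((hts x).mul_left 2),
            Summable.tsum_add (hts (x + h)) (hts (x - h)), tsum_mul_left]
      _ = ∑ j ∈ Finset.range N, (t j (x + h) + t j (x - h) - 2 * t j x)
          + ∑' j, (t (j + N) (x + h) + t (j + N) (x - h) - 2 * t (j + N) x) :=
          (hsum.sum_add_tsum_nat_add N).symm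
      _ ≤ (∑ j ∈ Finset.range N, a j * (3 * (δ j)⁻¹)) * ‖h‖ ^ 2
          + ∑' j, a (j + N) * (6 * ‖h‖) := by
          refine add_le_add ?_ (Summable.tsum_le_tsum (fun j => ?_)
            ((summable_nat_add_iff N).2 hsum) (((summable_nat_add_iff N).2 hasum).mul_right _))
          · rw [Finset.sum_mul]
            refine Finset.sum_le_sum fun j _ => ?_
            have := mul_le_mul_of_nonneg_left (smoothNorm_second_diff_le (hδ j) x h) (hapos j).le
            simp only [ht]
            linarith
          · have h1 := smoothNorm_add_le (δ (j + N)) x h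
            have h2 := smoothNorm_add_le (δ (j + N)) x (-h)
            rw [norm_neg, ← sub_eq_add_neg] at h2
            have := mul_le_mul_of_nonneg_left (add_le_add h1 h2) (hapos (j + N)).le
            simp only [ht]
            linarith
      _ ≤ _ := by
          rw [tsum_mul_right]
          nlinarith [norm_nonneg h, mul_le_mul_of_nonneg_right htail (norm_nonneg h)]

end Majorant

/-! ### Coercivity of maxima of finitely many affine functions. -/

section CoerciveFamily

variable {V : Type*} [NormedAddCommGroup V] [InnerProductSpace ℝ V]

/-- Finitely many linear forms with zero sum that separate the points of `Z` have a maximum that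
grows at least linearly on `Z`. -/
theorem exists_mul_norm_proj_le_inner {ι : Type*} [Fintype ι] [Nonempty ι] {η : ι → V}
    {Z : Submodule ℝ V} [FiniteDimensional ℝ Z] (h0 : ∑ i, η i = 0) (hηZ : ∀ i, η i ∈ Z)
    (hsep : ∀ z ∈ Z, (∀ i, ⟪η i, z⟫_ℝ = 0) → z = 0) :
    ∃ c > 0, ∀ x, ∃ i, c * ‖Z.orthogonalProjectionOnto x‖ ≤ ⟪η i, x⟫_ℝ := by
  set T : Z →ₗ[ℝ] (ι → ℝ) := LinearMap.pi fun i => (innerₛₗ ℝ (η i)).comp Z.subtype with hT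
  have hTa : ∀ z i, T z i = ⟪η i, (z : V)⟫_ℝ := fun z i => rfl
  obtain ⟨K, hK, hanti⟩ := LinearMap.exists_antilipschitzWith T <| by
    rw [LinearMap.ker_eq_bot']
    intro z hz
    exact Subtype.ext (hsep z z.2 fun i => by rw [← hTa, hz, Pi.zero_apply])
  have hK' : (0 : ℝ) < K := hK
  have hN : (0 : ℝ) < Fintype.card ι := by exact_mod_cast Fintype.card_pos
  refine ⟨1 / (2 * K * Fintype.card ι), by positivity, fun x => ?_⟩
  by_contra! hlt
  set z := Z.orthogonalProjectionOnto x with hz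
  set c : ℝ := 1 / (2 * K * Fintype.card ι) with hc
  have hc0 : 0 < c := by positivity
  have hinner : ∀ i, ⟪η i, x⟫_ℝ = T z i := fun i => by
    rw [hTa, hz]
    exact (Submodule.inner_orthogonalProjectionOnto_eq_of_mem_left ⟨η i, hηZ i⟩ x).symm
  simp only [hinner] at hlt
  have hsum : ∑ i, T z i = 0 := by
    simp only [hTa, ← sum_inner, h0, inner_zero_left]
  -- Numbers with zero sum, all below `c * ‖z‖`, cannot be very negative either. The choice of `c`
  -- then yields `‖z‖ ≤ ‖z‖ / 2`; with `z = 0` all forms would be strictly negative, against the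
  -- zero sum.
  have hbound : ‖T z‖ ≤ Fintype.card ι * (c * ‖z‖) := by
    rw [pi_norm_le_iff_of_nonneg (by positivity)]
    intro i
    have h1 : c * ‖z‖ - T z i ≤ ∑ j, (c * ‖z‖ - T z j) :=
      Finset.single_le_sum (f := fun j => c * ‖z‖ - T z j)
        (fun j _ => (sub_pos.2 (hlt j)).le) (Finset.mem_univ i)
    rw [Finset.sum_sub_distrib, hsum, sub_zero, Finset.sum_const, Finset.card_univ,
      nsmul_eq_mul] at h1
    have h2 : c * ‖z‖ ≤ Fintype.card ι * (c * ‖z‖) :=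
      le_mul_of_one_le_left (by positivity) (by exact_mod_cast Fintype.card_pos)
    have h3 : 0 ≤ c * ‖z‖ := by positivity
    exact abs_le.2 ⟨by linarith, by linarith [hlt i]⟩
  have h4 : ‖z‖ ≤ K * ‖T z‖ := hanti.le_mul_norm (map_zero T) z
  have h5 : (K : ℝ) * (Fintype.card ι * (c * ‖z‖)) = ‖z‖ / 2 := by
    rw [hc]
    field_simp
  have h6 : ‖z‖ = 0 := le_antisymm
    (by linarith [mul_le_mul_of_nonneg_left hbound hK'.le]) (norm_nonneg z)
  rw [h6, mul_zero] at hlt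
  have := Finset.sum_neg (fun i _ => hlt i) (Finset.univ_nonempty (α := ι))
  linarith

/-- Strict convexity of the ball: the mean `v` of points of the ball reaches the sphere only if they
all coincide. The gap `M - ‖v‖` is the room for tilting slopes. -/
theorem norm_lt_of_sum_sub_eq_zero {ι : Type*} [Fintype ι] {ξ : ι → V} {v : V} {M : ℝ}
    (h0 : ∑ i, (ξ i - v) = 0) (hM : ∀ i, ‖ξ i‖ ≤ M) (hne : ∃ i j, ξ i ≠ ξ j) : ‖v‖ < M := by
  by_contra! hle
  have hterm : ∀ i, ⟪ξ i - v, v⟫_ℝ ≤ 0 := fun i => by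
    rw [inner_sub_left, real_inner_self_eq_norm_sq]
    nlinarith [real_inner_le_norm (ξ i) v, norm_nonneg v, hM i]
  have hsum : ∑ i, ⟪ξ i - v, v⟫_ℝ = 0 := by rw [← sum_inner, h0, inner_zero_left]
  have hzero : ∀ i, ⟪ξ i - v, v⟫_ℝ = 0 := fun i =>
    (Finset.sum_eq_zero_iff_of_nonpos fun i _ => hterm i).1 hsum i (Finset.mem_univ i)
  have heq : ∀ i, ξ i = v := fun i => by
    have h1 := norm_add_sq_real (ξ i - v) v
    rw [sub_add_cancel, hzero i] at h1
    have h2 : ‖ξ i‖ ^ 2 ≤ ‖v‖ ^ 2 := pow_le_pow_left₀ (norm_nonneg _) ((hM i).trans hle) 2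
    rw [← sub_eq_zero, ← norm_eq_zero, ← sq_eq_zero_iff]
    exact le_antisymm (by linarith) (sq_nonneg _)
  obtain ⟨i, j, hij⟩ := hne
  exact hij ((heq i).trans (heq j).symm)

/-- The maximum of finitely many affine functions, whose slopes differ by elements spanning `Z`,
grows at least linearly in the directions of `Z` up to a linear form. -/
theorem exists_affine_add_norm_proj_le {ι : Type*} [Fintype ι] [Nonempty ι] {ξ : ι → V} (b : ι → ℝ)
    {Z : Submodule ℝ V} [FiniteDimensional ℝ Z] {M : ℝ} (hM : ∀ i, ‖ξ i‖ ≤ M)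
    (hξZ : ∀ i j, ξ i - ξ j ∈ Z) (hsep : ∀ z, (∀ i j, ⟪ξ i - ξ j, z⟫_ℝ = 0) → z ∈ Zᗮ) :
    ∃ v : V, ∃ c > 0, ∃ C : ℝ, ‖v‖ ≤ M ∧ ((∃ i j, ξ i ≠ ξ j) → ‖v‖ < M) ∧ (∀ i, ξ i - v ∈ Z) ∧
      ∀ x, ∃ i, ⟪v, x⟫_ℝ + c * ‖Z.orthogonalProjectionOnto x‖ - C ≤ ⟪ξ i, x⟫_ℝ + b i := by
  have hN : (0 : ℝ) < Fintype.card ι := by exact_mod_cast Fintype.card_pos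
  set v : V := (Fintype.card ι : ℝ)⁻¹ • ∑ i, ξ i with hv
  have h0 : ∑ i, (ξ i - v) = 0 := by
    rw [Finset.sum_sub_distrib, Finset.sum_const, Finset.card_univ, ← Nat.cast_smul_eq_nsmul ℝ,
      hv, smul_inv_smul₀ hN.ne', sub_self]
  have hvZ : ∀ i, ξ i - v ∈ Z := fun i => by
    have h1 : ξ i - v = (Fintype.card ι : ℝ)⁻¹ • ∑ j, (ξ i - ξ j) := by
      rw [Finset.sum_sub_distrib, Finset.sum_const, Finset.card_univ, ← Nat.cast_smul_eq_nsmul ℝ,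
        smul_sub, inv_smul_smul₀ hN.ne']
    rw [h1]
    exact Z.smul_mem _ (Z.sum_mem fun j _ => hξZ i j)
  have hlt : (∃ i j, ξ i ≠ ξ j) → ‖v‖ < M := norm_lt_of_sum_sub_eq_zero h0 hM
  have hle : ‖v‖ ≤ M := by
    by_cases hne : ∃ i j, ξ i ≠ ξ j
    · exact (hlt hne).le
    · push Not at hne
      have i₀ : ι := Classical.arbitrary ι
      have : v = ξ i₀ := by
        simp only [hne _ i₀, Finset.sum_const, Finset.card_univ, ← Nat.cast_smul_eq_nsmul ℝ,
          smul_smul, inv_mul_cancel₀ hN.ne', one_smul] at hv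
        exact hv
      exact this ▸ hM i₀
  obtain ⟨c, hc, hcx⟩ := exists_mul_norm_proj_le_inner h0 hvZ fun z hz hzero => by
    have hmem : z ∈ Zᗮ := hsep z fun i j => by
      rw [← sub_sub_sub_cancel_right (ξ i) (ξ j) v, inner_sub_left, hzero, hzero, sub_zero]
    exact inner_self_eq_zero.1 (Submodule.inner_right_of_mem_orthogonal hz hmem)
  refine ⟨v, c, hc, ∑ i, |b i|, hle, hlt, hvZ, fun x => ?_⟩
  obtain ⟨i, hi⟩ := hcx x
  refine ⟨i, ?_⟩
  have h1 := Finset.single_le_sum (fun j _ => abs_nonneg (b j)) (Finset.mem_univ i)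
  rw [inner_sub_left] at hi
  linarith [neg_abs_le (b i)]

end CoerciveFamily

/-! ### The extension theorem for a coercive family of minorants. -/

section Extension

variable {V : Type*} [NormedAddCommGroup V] [InnerProductSpace ℝ V]

/-- Affine minorants `⟪s j, ·⟫ + b j` of the values `f`, with slopes bounded by `M`, touch the
first order jets `(f, G)` in a uniformly smooth way, as soon as the jets are almost equal whenever
the minorant almost touches. -/
theorem minorant_le_jet_add {κ J : Type*} {pt : κ → V} {f : κ → ℝ} {G : κ → V}
    {s : J → V} {b : J → ℝ} {M : ℝ} (hs : ∀ j, ‖s j‖ ≤ M) (hG : ∀ y, ‖G y‖ ≤ M)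
    (hle : ∀ j y, ⟪s j, pt y⟫_ℝ + b j ≤ f y) {P : κ → Prop}
    (hP : ∀ ε > 0, ∃ η > 0, ∀ j y, P y → f y - (⟪s j, pt y⟫_ℝ + b j) < η → ‖s j - G y‖ < ε)
    {ε : ℝ} (hε : 0 < ε) :
    ∃ δ > 0, ∀ j y, P y → ∀ u, ‖u‖ ≤ δ →
      ⟪s j, pt y + u⟫_ℝ + b j ≤ f y + ⟪G y, u⟫_ℝ + ε * ‖u‖ := by
  obtain ⟨η, hη, h⟩ := hP ε hε
  refine ⟨η / (2 * |M| + 1), by positivity, fun j y hy u hu => ?_⟩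
  rw [le_div_iff₀ (by positivity)] at hu
  have h1 := real_inner_le_norm (s j - G y) u
  rw [inner_sub_left] at h1
  rw [inner_add_right]
  -- Either the slopes are `ε`-close, or the gap `η` absorbs the slope difference `2M` over the
  -- length `δ`.
  by_cases hgap : f y - (⟪s j, pt y⟫_ℝ + b j) < η
  · have h2 := mul_le_mul_of_nonneg_right (h j y hy hgap).le (norm_nonneg u)
    linarith [hle j y]
  · have h2 := mul_le_mul_of_nonneg_right ((norm_sub_le (s j) (G y)).trans
      (add_le_add (hs j) (hG y))) (norm_nonneg u)
    have h3 := mul_le_mul_of_nonneg_right (le_abs_self M) (norm_nonneg u)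
    have h4 : 0 ≤ ε * ‖u‖ := by positivity
    nlinarith [norm_nonneg u]

variable [CompleteSpace V]

/-- Jets `(f, G)` lying above a family of affine minorants, which contains the tangent affine
functions of the jets themselves and is coercive in the directions of `X`, extend to a convex `C¹`
function above the minorants, with the same bound on the slopes. -/
theorem exists_convex_contDiff_extension {κ J : Type*} [Nonempty κ] {pt : κ → V} {f : κ → ℝ}
    {G : κ → V} {s : J → V} {b : J → ℝ} {M c C₀ : ℝ} {v : V} (X : Submodule ℝ V)
    [X.HasOrthogonalProjection] (hs : ∀ j, ‖s j‖ ≤ M) (hG : ∀ y, ‖G y‖ ≤ M) (hv : ‖v‖ ≤ M)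
    (hle : ∀ j y, ⟪s j, pt y⟫_ℝ + b j ≤ f y)
    (htouch : ∀ y, ∃ j, s j = G y ∧ ⟪s j, pt y⟫_ℝ + b j = f y)
    (hsX : ∀ j, s j - v ∈ X) (hc : 0 < c)
    (hcoer : ∀ x, ∃ j, ⟪v, x⟫_ℝ + c * ‖X.orthogonalProjectionOnto x‖ - C₀ ≤ ⟪s j, x⟫_ℝ + b j)
    (hP : ∀ R : ℝ, ∀ ε > 0, ∃ η > 0, ∀ j y, ‖X.orthogonalProjectionOnto (pt y)‖ ≤ R →
      f y - (⟪s j, pt y⟫_ℝ + b j) < η → ‖s j - G y‖ < ε) :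
    ∃ F : V → ℝ, ConvexOn ℝ univ F ∧ (∀ x y, F x - F y ≤ M * ‖x - y‖) ∧ ContDiff ℝ 1 F ∧
      (∀ y, F (pt y) = f y ∧ HasGradientAt F (G y) (pt y)) ∧
      (∀ x, ∀ u ∈ Xᗮ, F (x + u) = F x + ⟪v, u⟫_ℝ) ∧
      ∀ x, ⟪v, x⟫_ℝ + c * ‖X.orthogonalProjectionOnto x‖ - C₀ ≤ F x := by
  have hM : 0 ≤ M := (norm_nonneg v).trans hv
  have hGX : ∀ y, G y - v ∈ X := fun y => by
    obtain ⟨j, hj, -⟩ := htouch y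
    exact hj ▸ hsX j
  have hGv : ∀ y, ∀ r ∈ Xᗮ, ⟪G y, r⟫_ℝ = ⟪v, r⟫_ℝ := fun y r hr => by
    rw [← sub_eq_zero, ← inner_sub_left]
    exact Submodule.inner_right_of_mem_orthogonal (hGX y) hr
  have hsv : ∀ j, ∀ r ∈ Xᗮ, ⟪s j, r⟫_ℝ = ⟪v, r⟫_ℝ := fun j r hr => by
    rw [← sub_eq_zero, ← inner_sub_left]
    exact Submodule.inner_right_of_mem_orthogonal (hsX j) hr
  have hinner2M : ∀ {a a' : V}, ‖a‖ ≤ M → ‖a'‖ ≤ M → ∀ u, ⟪a, u⟫_ℝ - ⟪a', u⟫_ℝ ≤ 2 * M * ‖u‖ := by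
    intro a a' ha ha' u
    rw [← inner_sub_left]
    refine (real_inner_le_norm _ _).trans (mul_le_mul_of_nonneg_right ?_ (norm_nonneg u))
    linarith [norm_sub_le a a']
  -- majorants of the errors on the shells `‖P_X‖ ≤ k`
  have hψ : ∀ k : ℕ, ∃ ψ : V → ℝ, ψ 0 = 0 ∧ (∀ u, 0 ≤ ψ u) ∧
      (∀ j y, ‖X.orthogonalProjectionOnto (pt y)‖ ≤ k →
        ∀ u, ⟪s j, pt y + u⟫_ℝ + b j ≤ f y + ⟪G y, u⟫_ℝ + ψ u) ∧ SmoothAboveOn ψ univ := by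
    intro k
    obtain ⟨ψ, h0, hnn, hmaj, hsm⟩ := exists_smooth_majorant
      (W := fun (i : J × {y : κ // ‖X.orthogonalProjectionOnto (pt y)‖ ≤ k}) u =>
        ⟪s i.1, pt i.2 + u⟫_ℝ + b i.1 - (f i.2 + ⟪G i.2, u⟫_ℝ))
      (B := 2 * M) (by positivity)
      (fun i u => by
        rw [inner_add_right]
        linarith [hle i.1 i.2, hinner2M (hs i.1) (hG i.2) u])
      (fun ε hε => by
        obtain ⟨δ, hδ, h⟩ := minorant_le_jet_add hs hG hle
          (P := fun y => ‖X.orthogonalProjectionOnto (pt y)‖ ≤ k) (hP k) hε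
        exact ⟨δ, hδ, fun i u hu => by linarith [h i.1 i.2 i.2.2 u hu]⟩)
    exact ⟨ψ, h0, hnn, fun j y hy u => by linarith [hmaj (j, ⟨y, hy⟩) u], hsm⟩
  choose ψ hψ0 hψnn hψmaj hψsm using hψ
  set k : κ → ℕ := fun y => ⌈‖X.orthogonalProjectionOnto (pt y)‖⌉₊ with hk
  -- The corrections see only the `X`-component, so `A y` has slope `v` along `Xᗮ`. The square
  -- compensates the loss `2M ‖P_X (a - pt y)‖` from replacing `G y` by `v`, at the cost of the
  -- constant `M ^ 2`.
  set A : κ → V → ℝ := fun y a => f y + ⟪G y, a - pt y⟫_ℝ + ψ (k y) (X.starProjection (a - pt y))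
    + ‖X.starProjection (a - pt y)‖ ^ 2 with hA
  have hrX : ∀ a : V, a - X.starProjection a ∈ Xᗮ := X.sub_starProjection_mem_orthogonal
  have hsplit : ∀ w a : V, ⟪w, a⟫_ℝ = ⟪w, X.starProjection a⟫_ℝ + ⟪w, a - X.starProjection a⟫_ℝ :=
    fun w a => by rw [← inner_add_right, add_sub_cancel]
  have hAs : ∀ y j a, ⟪s j, a⟫_ℝ + b j ≤ A y a := by
    intro y j a
    have h1 := hψmaj (k y) j y (Nat.le_ceil _) (X.starProjection (a - pt y))
    have h2 := hsplit (s j) (a - pt y)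
    have h3 := hsplit (G y) (a - pt y)
    rw [hsv j _ (hrX _)] at h2
    rw [hGv y _ (hrX _)] at h3
    rw [inner_sub_right] at h2
    rw [inner_add_right] at h1
    simp only [hA]
    nlinarith [sq_nonneg ‖X.starProjection (a - pt y)‖]
  have hAv : ∀ y a, ⟪v, a⟫_ℝ + c * ‖X.orthogonalProjectionOnto (pt y)‖ - (C₀ + M ^ 2) ≤ A y a := by
    intro y a
    obtain ⟨j, hj⟩ := hcoer (pt y)
    have h1 := hj.trans (hle j y)
    have h2 := hsplit v (a - pt y)
    have h3 := hsplit (G y) (a - pt y)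
    rw [hGv y _ (hrX _)] at h3
    rw [inner_sub_right] at h2
    have h4 := hinner2M hv (hG y) (X.starProjection (a - pt y))
    have h5 := hψnn (k y) (X.starProjection (a - pt y))
    simp only [hA]
    nlinarith [sq_nonneg (‖X.starProjection (a - pt y)‖ - M)]
  have hAsm : ∀ R, ∀ ε > 0, ∃ C : ℝ, 0 ≤ C ∧ ∀ y, c * ‖X.orthogonalProjectionOnto (pt y)‖ ≤ R →
      ∀ a h, A y (a + h) + A y (a - h) - 2 * A y a ≤ ε * ‖h‖ + C * ‖h‖ ^ 2 := by
    intro R ε hε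
    choose C hC hCsm using fun m => hψsm m ε hε
    -- Only finitely many `ψ m` occur on a sublevel set, so their constants can be added; the `2`
    -- comes from the square.
    refine ⟨∑ m ∈ Finset.range (⌈R / c⌉₊ + 1), C m + 2,
      add_nonneg (Finset.sum_nonneg fun m _ => hC m) two_pos.le, fun y hy a h => ?_⟩
    have hky : C (k y) ≤ ∑ m ∈ Finset.range (⌈R / c⌉₊ + 1), C m := by
      refine Finset.single_le_sum (fun m _ => hC m) (Finset.mem_range.2 (Nat.lt_succ_of_le ?_))
      refine Nat.ceil_mono ?_
      rw [le_div_iff₀ hc]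
      linarith
    have h1 := hCsm (k y) (X.starProjection (a - pt y)) (mem_univ _) (X.starProjection h)
    have h2 := parallelogram_law_with_norm ℝ (X.starProjection (a - pt y)) (X.starProjection h)
    have h3 : ‖X.starProjection h‖ ≤ ‖h‖ := X.norm_starProjection_apply_le h
    have h4 : ‖X.starProjection h‖ ^ 2 ≤ ‖h‖ ^ 2 := pow_le_pow_left₀ (norm_nonneg _) h3 2
    have h5 : (C (k y) + 2) * ‖X.starProjection h‖ ^ 2
        ≤ (∑ m ∈ Finset.range (⌈R / c⌉₊ + 1), C m + 2) * ‖h‖ ^ 2 :=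
      mul_le_mul (by linarith) h4 (sq_nonneg _)
        (add_nonneg (Finset.sum_nonneg fun m _ => hC m) two_pos.le)
    have h6 := mul_le_mul_of_nonneg_left h3 hε.le
    simp only [hA, add_sub_right_comm a h, sub_right_comm a h, map_add, map_sub X.starProjection _ h,
      inner_add_right, inner_sub_right _ _ h]
    nlinarith
  set S : Set (V × ℝ) := {p | ∃ y, p.2 = A y p.1} with hS
  have hne : S.Nonempty := ⟨(0, A (Classical.arbitrary κ) 0), _, rfl⟩
  have hconv : ∀ j, ConvexOn ℝ univ fun x : V => ⟪s j, x⟫_ℝ + b j := fun j =>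
    ((innerₛₗ ℝ (s j)).convexOn convex_univ).add (convexOn_const (b j) convex_univ)
  have hLip : ∀ j (x y : V), (⟪s j, x⟫_ℝ + b j) - (⟪s j, y⟫_ℝ + b j) ≤ M * ‖x - y‖ := by
    intro j x y
    rw [add_sub_add_right_eq_sub, ← inner_sub_right]
    exact (real_inner_le_norm _ _).trans (mul_le_mul_of_nonneg_right (hs j) (norm_nonneg _))
  have hSs : ∀ j, ∀ p ∈ S, ⟪s j, p.1⟫_ℝ + b j ≤ p.2 := by
    rintro j p ⟨y, hy⟩
    exact hy ▸ hAs y j p.1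
  obtain ⟨j₀, -⟩ := hcoer 0
  set F := lipEnvelope M S with hF
  have hFconv : ConvexOn ℝ univ F := convexOn_lipEnvelope hM hne (hconv j₀) (hLip j₀) (hSs j₀)
  have hFLip : ∀ x y, F x - F y ≤ M * ‖x - y‖ :=
    lipEnvelope_sub_le hM hne (hconv j₀) (hLip j₀) (hSs j₀)
  have hFabs : ∀ x y, |F x - F y| ≤ M * ‖x - y‖ := fun x y =>
    abs_sub_le_iff.2 ⟨hFLip x y, norm_sub_rev x y ▸ hFLip y x⟩
  have hFcont : Continuous F := (LipschitzWith.of_dist_le_mul (K := M.toNNReal) fun x y => by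
    rw [Real.dist_eq, dist_eq_norm, Real.coe_toNNReal _ hM]
    exact hFabs x y).continuous
  have hFs : ∀ j x, ⟪s j, x⟫_ℝ + b j ≤ F x := fun j =>
    le_lipEnvelope hne (hconv j) (hLip j) (hSs j)
  have hFsm : ∀ x, SmoothAboveOn F {x} :=
    smoothAboveOn_lipEnvelope hv (fun y => by positivity) hAv hAsm
  choose g hg using hFconv.exists_subgradient hFcont
  refine ⟨F, hFconv, hFLip,
    contDiff_one_of_hasGradientAt hFabs hg fun x => (hFsm x).hasGradientAt (hg x), fun y => ?_,
    fun x u hu => ?_, fun x => ?_⟩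
  · obtain ⟨j, hj, hjy⟩ := htouch y
    have hFy : F (pt y) = f y := by
      refine le_antisymm ?_ (hjy ▸ hFs j (pt y))
      have hmem : (pt y, f y) ∈ S := ⟨y, by simp [hA, hψ0]⟩
      simpa using lipEnvelope_le_of_mem (hconv j₀) (hLip j₀) (hSs j₀)
        (subset_convexHull ℝ S hmem) (pt y)
    -- The touching minorant makes `G y` a subgradient of `F` at `pt y`.
    refine ⟨hFy, (hFsm _).hasGradientAt fun x => ?_⟩
    have h1 := hFs j x
    rw [hFy, ← hj, inner_sub_right]
    linarith
  · have hinv : ∀ u ∈ Xᗮ, ∀ x, F (x + u) ≤ F x + ⟪v, u⟫_ℝ := fun u hu =>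
      lipEnvelope_add_le hne (hconv j₀) (hLip j₀) (hSs j₀) <| by
        rintro p ⟨y, hy⟩
        refine ⟨y, ?_⟩
        have hu0 : X.starProjection u = 0 := X.starProjection_apply_eq_zero_iff.2 hu
        simp only [hA, Prod.fst_add, Prod.snd_add, add_sub_right_comm _ u, map_add, hu0, add_zero,
          inner_add_right, hy, hGv y u hu]
        ring
    refine le_antisymm (hinv u hu x) ?_
    have h1 := hinv (-u) (Xᗮ.neg_mem hu) (x + u)
    rw [add_neg_cancel_right, inner_neg_right] at h1
    linarith
  · obtain ⟨j, hj⟩ := hcoer x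
    exact hj.trans (hFs j x)

end Extension

theorem mem_orthogonal_span {V : Type*} [NormedAddCommGroup V] [InnerProductSpace ℝ V] {s : Set V}
    {u : V} (h : ∀ a ∈ s, ⟪a, u⟫_ℝ = 0) : u ∈ (Submodule.span ℝ s)ᗮ := by
  have hle : Submodule.span ℝ s ≤ (ℝ ∙ u)ᗮ :=
    Submodule.span_le.2 fun a ha => (Submodule.mem_orthogonal_singleton_iff_inner_left).2 (h a ha)
  exact fun a ha => Submodule.mem_orthogonal_singleton_iff_inner_left.1 (hle ha)

/-! ### Consequences of the hypotheses on the jets. -/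

section Jets

variable {n : ℕ} {E : Set (Eucl n)}

theorem sub_mem_jetSpan (G : E → Eucl n) (x y : E) : G x - G y ∈ jetSpan G :=
  Submodule.subset_span ⟨x, y, rfl⟩

/-- Finitely many slopes already detect the orthogonal complement of `jetSpan G`. -/
theorem exists_finite_separating_jets (G : E → Eucl n) (x₀ : E) :
    ∃ (m : ℕ) (e : Fin (m + 1) → E),
      ∀ u, (∀ i j, ⟪G (e i) - G (e j), u⟫_ℝ = 0) → u ∈ (jetSpan G)ᗮ := by
  obtain ⟨g, hg, hspan, -⟩ := Submodule.exists_fun_fin_finrank_span_eq ℝ (range fun y => G y - G x₀)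
  choose y hy using hg
  -- Including the base point `x₀` puts the spanning vectors `G (y i) - G x₀` among the pairwise
  -- differences.
  refine ⟨_, Fin.cons x₀ y, fun u hu => ?_⟩
  have hg0 : ∀ i, ⟪g i, u⟫_ℝ = 0 := fun i => by
    rw [← hy i]
    simpa using hu i.succ 0
  have hmem : ∀ z, ⟪G z - G x₀, u⟫_ℝ = 0 := fun z => by
    refine Submodule.inner_right_of_mem_orthogonal (hspan.ge (Submodule.subset_span ⟨z, rfl⟩))
      (mem_orthogonal_span ?_)
    rintro _ ⟨i, rfl⟩
    exact hg0 i
  refine mem_orthogonal_span ?_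
  rintro _ ⟨z, z', rfl⟩
  rw [← sub_sub_sub_cancel_right (G z) (G z') (G x₀), inner_sub_left, hmem, hmem, sub_zero]

/-- The directions of the cone condition, which together with `jetSpan G` separate the points
of `X`; there are none if `jetSpan G = X`. -/
theorem CondCone.exists_directions {G : E → Eucl n} {X : Submodule ℝ (Eucl n)}
    (hS : CondS G X) (h : CondCone G X) :
    ∃ (N : ℕ) (p w : Fin N → Eucl n) (ε : ℝ), 0 < ε ∧ (∀ j, ‖w j‖ = 1) ∧ (∀ j, w j ∈ X) ∧
      (∀ z ∈ X, z ∈ (jetSpan G)ᗮ → (∀ j, ⟪w j, z⟫_ℝ = 0) → z = 0) ∧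
      ∀ j, ∀ y : E, ε * ⟪w j, y - p j⟫_ℝ ≤ ‖(jetSpan G).orthogonalProjectionOnto (y - p j)‖ := by
  by_cases hYX : jetSpan G = X
  · refine ⟨0, Fin.elim0, Fin.elim0, 1, one_pos, fun j => j.elim0, fun j => j.elim0,
      fun z hz hz' _ => ?_, fun j => j.elim0⟩
    rw [hYX] at hz'
    exact inner_self_eq_zero.1 (Submodule.inner_right_of_mem_orthogonal hz hz')
  obtain ⟨p, ε, w, -, hε, -, hli, hw1, hwX, hcone⟩ := h hYX
  refine ⟨_, p, w, ε, hε, hw1, fun j => (hwX j).1, fun z hz hz' hzw => ?_, fun j y => ?_⟩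
  · have hspan : Submodule.span ℝ (range w) ≤ (jetSpan G)ᗮ := by
      rw [Submodule.span_le]
      rintro _ ⟨j, rfl⟩
      exact (hwX j).2
    -- The `w j` are orthogonal to `jetSpan G` and their number is its codimension in `X`, so the
    -- two spans fill `X`.
    have hle : jetSpan G ⊔ Submodule.span ℝ (range w) ≤ X := by
      refine sup_le hS (Submodule.span_le.2 ?_)
      rintro _ ⟨j, rfl⟩
      exact (hwX j).1
    have hinf : jetSpan G ⊓ Submodule.span ℝ (range w) = ⊥ :=
      le_bot_iff.1 ((inf_le_inf_left _ hspan).trans_eq (Submodule.inf_orthogonal_eq_bot _))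
    have hdim := Submodule.finrank_sup_add_finrank_inf_eq (jetSpan G) (Submodule.span ℝ (range w))
    rw [hinf, finrank_bot, finrank_span_eq_card hli, Fintype.card_fin] at hdim
    have hmono := Submodule.finrank_mono (show jetSpan G ≤ X from hS)
    have heq : jetSpan G ⊔ Submodule.span ℝ (range w) = X :=
      Submodule.eq_of_le_of_finrank_eq hle (by omega)
    have hz'' : z ∈ (Submodule.span ℝ (range w))ᗮ := mem_orthogonal_span <| by
      rintro _ ⟨j, rfl⟩
      exact hzw j
    have hzX : z ∈ Xᗮ := by
      rw [← heq, ← Submodule.inf_orthogonal]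
      exact ⟨hz', hz''⟩
    exact inner_self_eq_zero.1 (Submodule.inner_right_of_mem_orthogonal hz hzX)
  · by_contra! hlt
    have hmem : (y : Eucl n) ∈ cone (jetSpan G) ε (w j) (p j) ∩ closure E :=
      ⟨hlt.le, subset_closure y.2⟩
    rw [hcone j] at hmem
    exact hmem

/-- The quantitative form of `CondCW`. -/
theorem CondCW.exists_pos {f : E → ℝ} {G : E → Eucl n} {X : Submodule ℝ (Eucl n)}
    (h : CondCW f G X) (hf : ∀ x y : E, f y + ⟪G y, (x : Eucl n) - y⟫_ℝ ≤ f x) (R : ℝ) {ε : ℝ}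
    (hε : 0 < ε) :
    ∃ η > 0, ∀ z y : E, ‖X.orthogonalProjectionOnto (y : Eucl n)‖ ≤ R →
      f y - f z - ⟪G z, (y : Eucl n) - z⟫_ℝ < η → ‖G z - G y‖ < ε := by
  by_contra! hcon
  choose z y hR hgap hge using fun j : ℕ => hcon (1 / ((j : ℝ) + 1)) (by positivity)
  have hlim := h y z (isBounded_iff_forall_norm_le.2 ⟨R, by rintro _ ⟨j, rfl⟩; exact hR j⟩)
    (squeeze_zero (fun j => by linarith [hf (y j) (z j)]) (fun j => (hgap j).le)
      tendsto_one_div_add_atTop_nhds_zero_nat)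
  obtain ⟨j, hj⟩ := (hlim.eventually_lt_const hε).exists
  rw [norm_sub_rev] at hj
  exact (hge j).not_gt hj

end Jets

/-! ### Lipschitz constant, coercivity subspace and conclusion. -/

/-- If `F` is `M`-Lipschitz and `M` is at most every upper bound of the gradient norms, then
`M = Lip(F)` is the supremum of these norms. -/
theorem isLUB_norm_gradient_lipConst {n : ℕ} {F : Eucl n → ℝ} {M : ℝ} (hM : 0 ≤ M)
    (hF : ∀ x y, |F x - F y| ≤ M * ‖x - y‖)
    (hsup : M ∈ lowerBounds (upperBounds (range fun x => ‖∇ F x‖))) :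
    lipConst F = M ∧ IsLUB (range fun x => ‖∇ F x‖) M := by
  have hgrad : ∀ C : ℝ, 0 ≤ C → (∀ x y, |F x - F y| ≤ C * ‖x - y‖) → ∀ x, ‖∇ F x‖ ≤ C := by
    intro C hC hFC x
    rw [gradient, LinearIsometryEquiv.norm_map]
    exact norm_fderiv_le_of_lip' ℝ hC (Eventually.of_forall fun y => hFC y x)
  have hub : M ∈ upperBounds (range fun x => ‖∇ F x‖) := by
    rintro _ ⟨x, rfl⟩
    exact hgrad M hM hF x
  refine ⟨le_antisymm (csInf_le ⟨0, fun C hC => hC.1⟩ ⟨hM, hF⟩)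
    (le_csInf ⟨M, hM, hF⟩ fun C hC => hsup ?_), hub, hsup⟩
  rintro _ ⟨x, rfl⟩
  exact hgrad C hC.1 hC.2 x

theorem IsCoercivitySubspace.of_lower_bound {n : ℕ} {F : Eucl n → ℝ} {X : Submodule ℝ (Eucl n)}
    {v : Eucl n} {c C : ℝ} (hF : ConvexOn ℝ univ F) (hc : 0 < c)
    (hinv : ∀ x, ∀ u ∈ Xᗮ, F (x + u) = F x + ⟪v, u⟫_ℝ)
    (hlow : ∀ x, ⟪v, x⟫_ℝ + c * ‖X.orthogonalProjectionOnto x‖ - C ≤ F x) :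
    IsCoercivitySubspace F X := by
  refine ⟨fun z => F z - ⟪v, (z : Eucl n)⟫_ℝ, v, ?_, ?_, fun x => ?_⟩
  · exact (hF.comp_linearMap X.subtype).sub
      (((innerₛₗ ℝ v).comp X.subtype).concaveOn convex_univ)
  · refine tendsto_atTop_mono (f := fun z : X => c * ‖z‖ + -C) (fun z => ?_)
      (tendsto_atTop_add_const_right _ _ (tendsto_norm_cobounded_atTop.const_mul_atTop hc))
    have := hlow z
    rw [Submodule.orthogonalProjectionOnto_mem_subspace_eq_self] at this
    linarith
  · have h1 := hinv (X.starProjection x) _ (X.sub_starProjection_mem_orthogonal x)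
    rw [add_sub_cancel, inner_sub_right] at h1
    rw [h1, Submodule.starProjection_apply]
    ring

theorem theorem1p1 (n : ℕ) (E : Set (Eucl n)) (X : Submodule ℝ (Eucl n))
    (f : E → ℝ) (G : E → Eucl n)
    (hG : ∃ x y : E, G x ≠ G y)
    (hCb : CondCb f G)
    (hS : CondS G X)
    (hCone : CondCone G X)
    (hCW : CondCW f G X) :
    ∃ F : Eucl n → ℝ,
      ConvexOn ℝ univ F ∧
      (∃ K, LipschitzWith K F) ∧
      ContDiff ℝ 1 F ∧
      (∀ x : E, F x = f x ∧ ∇ F (x : Eucl n) = G x) ∧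
      IsCoercivitySubspace F X ∧
      IsLUB (range fun x : Eucl n => ‖∇ F x‖) (lipConst F) ∧
      IsLUB (range fun y : E => ‖G y‖) (lipConst F) := by
  obtain ⟨x₀, y₀, hxy⟩ := hG
  obtain ⟨-, hbdd, hf⟩ := hCb
  have : Nonempty E := ⟨x₀⟩
  obtain ⟨M, hMlub⟩ : ∃ M, IsLUB (range fun y : E => ‖G y‖) M := by
    obtain ⟨B, hB⟩ := isBounded_iff_forall_norm_le.1 hbdd
    exact ⟨_, isLUB_csSup (range_nonempty _) ⟨B, by rintro _ ⟨y, rfl⟩; exact hB _ ⟨y, rfl⟩⟩⟩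
  have hGM : ∀ y, ‖G y‖ ≤ M := fun y => hMlub.1 ⟨y, rfl⟩
  have hM : 0 ≤ M := (norm_nonneg _).trans (hGM x₀)
  obtain ⟨m, e, he⟩ := exists_finite_separating_jets G x₀
  obtain ⟨N, p, w, ε, hε, hw1, hwX, hwsep, hwcone⟩ := hCone.exists_directions hS
  -- coercivity of the given jets along `jetSpan G`
  obtain ⟨v, c, hc, C, -, hvlt, hvY, hcoer⟩ := exists_affine_add_norm_proj_le
    (ξ := fun i => G (e i)) (fun i => f (e i) - ⟪G (e i), (e i : Eucl n)⟫_ℝ) (Z := jetSpan G)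
    (fun i => hGM (e i)) (fun i j => sub_mem_jetSpan G _ _) he
  have hvM : ‖v‖ < M := hvlt <| by
    by_contra! hall
    refine hxy (sub_eq_zero.1 (inner_self_eq_zero (𝕜 := ℝ).1
      (Submodule.inner_right_of_mem_orthogonal (sub_mem_jetSpan G x₀ y₀) (he _ fun i j => ?_))))
    rw [hall i j, sub_self, inner_zero_left]
  -- tilted affine minorants, coercive in the remaining directions of `X`
  obtain ⟨δ, hδ, hδc, hδM⟩ : ∃ δ > 0, δ ≤ c * ε ∧ δ ≤ M - ‖v‖ :=
    ⟨min (c * ε) (M - ‖v‖), lt_min (mul_pos hc hε) (sub_pos.2 hvM), min_le_left _ _,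
      min_le_right _ _⟩
  -- `δ ≤ M - ‖v‖` keeps the tilted slopes in the ball, and `δ ≤ c * ε` lets the growth `c |P_Y y|`
  -- dominate the tilt outside the cones. The `+ 1` in `b` places the tilted functions below `f -
  -- 1`, so they never almost touch the data.
  set s : E ⊕ Fin N → Eucl n := Sum.elim G fun j => v + δ • w j with hs
  set b : E ⊕ Fin N → ℝ := Sum.elim (fun y => f y - ⟪G y, (y : Eucl n)⟫_ℝ) fun j =>
    -(δ * ⟪w j, p j⟫_ℝ) - (C + c * ‖(jetSpan G).orthogonalProjectionOnto (p j)‖ + 1) with hb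
  have hsM : ∀ j, ‖s j‖ ≤ M := by
    rintro (y | j)
    · exact hGM y
    · refine (norm_add_le _ _).trans ?_
      rw [norm_smul, hw1, Real.norm_of_nonneg hδ.le]
      linarith
  have hGv : ∀ y, G y - v ∈ jetSpan G := fun y => by
    simpa using add_mem (sub_mem_jetSpan G y (e 0)) (hvY 0)
  have hsvX : ∀ j, s j - v ∈ X := by
    rintro (y | j)
    · exact hS (hGv y)
    · simpa [hs] using X.smul_mem δ (hwX j)
  have hle_inl : ∀ z y : E, ⟪s (.inl z), (y : Eucl n)⟫_ℝ + b (.inl z) ≤ f y := fun z y => by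
    have h1 := hf y z
    rw [inner_sub_right] at h1
    simp only [hs, hb, Sum.elim_inl]
    linarith
  have hle_inr : ∀ j (y : E), ⟪s (.inr j), (y : Eucl n)⟫_ℝ + b (.inr j) ≤ f y - 1 := fun j y => by
    obtain ⟨i, hi⟩ := hcoer y
    have h1 := hle_inl (e i) y
    simp only [hs, hb, Sum.elim_inl] at h1
    have h2 : δ * ⟪w j, y - p j⟫_ℝ ≤ c * ‖(jetSpan G).orthogonalProjectionOnto (y - p j)‖ := by
      rcases le_total ⟪w j, (y : Eucl n) - p j⟫_ℝ 0 with h0 | h0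
      · exact (mul_nonpos_of_nonneg_of_nonpos hδ.le h0).trans (by positivity)
      · refine (mul_le_mul_of_nonneg_right hδc h0).trans ?_
        rw [mul_assoc]
        exact mul_le_mul_of_nonneg_left (hwcone j y) hc.le
    have h3 : ‖(jetSpan G).orthogonalProjectionOnto (y - p j)‖
        ≤ ‖(jetSpan G).orthogonalProjectionOnto (y : Eucl n)‖
          + ‖(jetSpan G).orthogonalProjectionOnto (p j)‖ := by
      rw [map_sub]
      exact norm_sub_le _ _
    have h4 := mul_le_mul_of_nonneg_left h3 hc.le
    rw [inner_sub_right] at h2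
    simp only [hs, hb, Sum.elim_inr, inner_add_left, real_inner_smul_left]
    linarith
  obtain ⟨v', c', hc', C', hv'M, -, hv'X, hcoer'⟩ := exists_affine_add_norm_proj_le
    (ξ := fun i : Fin (m + 1) ⊕ Fin N => s (Sum.map e id i)) (fun i => b (Sum.map e id i)) (Z := X)
    (fun i => hsM _) (fun i j => by
      simpa using sub_mem (hsvX (Sum.map e id i)) (hsvX (Sum.map e id j)))
    (fun z hz => by
      have hproj : ∀ a ∈ X, ⟪a, X.starProjection z⟫_ℝ = ⟪a, z⟫_ℝ := fun a ha => by
        have := Submodule.inner_right_of_mem_orthogonal ha (X.sub_starProjection_mem_orthogonal z)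
        rw [inner_sub_right] at this
        linarith
      rw [← X.starProjection_apply_eq_zero_iff]
      have hzY : X.starProjection z ∈ (jetSpan G)ᗮ := he _ fun i j => by
        rw [hproj _ (hS (sub_mem_jetSpan G _ _))]
        exact hz (.inl i) (.inl j)
      refine hwsep _ (X.starProjection_apply_mem z) hzY fun j => ?_
      -- This slope difference is an element of `jetSpan G` minus `δ • w j`; the former is
      -- orthogonal to the projection of `z`, leaving only `w j`.
      have h1 := hz (.inl 0) (.inr j)
      simp only [hs, Sum.map_inl, Sum.map_inr, Sum.elim_inl, Sum.elim_inr, id, sub_add_eq_sub_sub]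
        at h1
      rw [inner_sub_left, ← hproj _ (hS (hGv _)),
        Submodule.inner_right_of_mem_orthogonal (hGv _) hzY, zero_sub, neg_eq_zero,
        real_inner_smul_left] at h1
      rw [hproj _ (hwX j)]
      exact (mul_eq_zero.1 h1).resolve_left hδ.ne')
  have hsv'X : ∀ j, s j - v' ∈ X := fun j => by
    have h1 := add_mem (sub_mem (hsvX j) (hsvX (.inl (e 0)))) (hv'X (.inl 0))
    simpa using h1
  obtain ⟨F, hFconv, hFLip, hFdiff, hFE, hFinv, hFlow⟩ := exists_convex_contDiff_extension
    (pt := fun y : E => (y : Eucl n)) (f := f) (G := G) (b := b) (c := c') (C₀ := C') X hsM hGM hv'M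
    (by
      rintro (z | j) y
      · exact hle_inl z y
      · linarith [hle_inr j y])
    (fun y => ⟨.inl y, rfl, by simp [hs, hb]⟩) hsv'X hc'
    (fun x => (hcoer' x).imp' (Sum.map e id) fun i hi => hi)
    (fun R r hr => by
      obtain ⟨η, hη, h⟩ := hCW.exists_pos hf R hr
      -- A gap below `1` excludes the tilted minorants, so only the jets, governed by `hCW`, remain.
      refine ⟨min η 1, lt_min hη one_pos, ?_⟩
      rintro (z | j) y hy hgap
      · refine h z y hy ?_
        rw [inner_sub_right]
        simp only [hs, hb, Sum.elim_inl] at hgap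
        linarith [min_le_left η 1]
      · linarith [hle_inr j y, min_le_right η 1])
  have hFabs : ∀ x y, |F x - F y| ≤ M * ‖x - y‖ := fun x y =>
    abs_sub_le_iff.2 ⟨hFLip x y, norm_sub_rev x y ▸ hFLip y x⟩
  have hgrad : ∀ x : E, ∇ F (x : Eucl n) = G x := fun x => (hFE x).2.gradient
  obtain ⟨hlip, hlub⟩ := isLUB_norm_gradient_lipConst hM hFabs fun B hB => hMlub.2 <| by
    rintro _ ⟨y, rfl⟩
    exact hB ⟨y, by simp only [hgrad]⟩
  refine ⟨F, hFconv, ⟨M.toNNReal, .of_dist_le_mul fun x y => ?_⟩, hFdiff,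
    fun x => ⟨(hFE x).1, hgrad x⟩, .of_lower_bound hFconv hc' hFinv hFlow, hlip ▸ hlub,
    hlip ▸ hMlub⟩
  rw [Real.dist_eq, dist_eq_norm, Real.coe_toNNReal _ hM]
  exact hFabs x y
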